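/- Let $A>0$, $k>0$, $\alpha>1$. For $M>0$ let $\Gamma_M$ be the set of all $C^1$ curves $\gamma=(\gamma_1,\gamma_2):[0,1]\to\mathbb{R}^2$ with $\gamma(0)=0$ and $\|\dot\gamma(s)\|\le M$ for all $s\in[0,1]$; every $C^1$ curve on $[0,1]$ with $\gamma(0)=0$ lies in $\Gamma_M$ for some $M$. For $\gamma\in\Gamma_M$ and $\omega,\delta>0$ put $\gamma^\delta(t)=\gamma(\delta t)$ and $p(t)=(p_1(t),p_2(t))=(\cos\omega t,\sin\omega t)+\gamma^\delta(t)$ for $t\in[0,1/\delta]$, and consider, for $\mathbf X=[x,v_x,y,v_y]^T$, the initial value problem $$\dot x=v_x,\qquad \dot v_x=\frac{A\,(x-p_1(t))}{[(x-p_1(t))^2+(y-p_2(t))^2]^{\alpha}}-k v_x,$$ $$\dot y=v_y,\qquad \dot v_y=\frac{A\,(y-p_2(t))}{[(x-p_1(t))^2+(y-p_2(t))^2]^{\alpha}}-k v_y,\qquad \mathbf X(0)=\mathbf X_0,$$ where a solution is required to satisfy $(x(t),y(t))\ne p(t)$ at all times. All norms are Euclidean. 1. There exist $r_1>0$ and $\omega_1>0$,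 depending only on $A,k,\alpha$, and for every $M>0$ a $\delta_1>0$, depending only on $A,k,\alpha,M$, such that for all $\gamma\in\Gamma_M$, $\omega>\omega_1$, $\delta\in(0,\delta_1)$ and $\mathbf X_0\in\mathbb{R}^4$ with $\|\mathbf X_0\|\le r_1$, the problem has a unique solution on the whole interval $[0,1/\delta]$, and $$\|(x(t),y(t))-\gamma^\delta(t)\|<1\qquad\text{for all }t\in[0,1/\delta].$$ 2. Let $\mathbf X_0=\mathbf 0$. For every $\nu>0$ there exists $\omega_2>0$, depending only on $A,k,\alpha,\nu$, and for every $M>0$ a $\delta_2>0$, depending only on $A,k,\alpha,\nu,M$, such that for all $\gamma\in\Gamma_M$, $\omega>\omega_2$ and $\delta\in(0,\delta_2)$ the problem has a unique solution on $[0,1/\delta]$, and $$\|(x(t),y(t))-\gamma^\delta(t)\|<\nu\qquad\text{for all }t\in[0,1/\delta].$$ -/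

import Mathlib

open Set

noncomputable section

/-- Position at time `t` of the leader: a unit circular motion of frequency `ω`, superposed on the
slowed-down target trajectory `t ↦ γ (δ t)`. -/
def leaderPos (ω δ : ℝ) (γ : ℝ → EuclideanSpace ℝ (Fin 2)) (t : ℝ) : EuclideanSpace ℝ (Fin 2) :=
  !₂[Real.cos (ω * t) + γ (δ * t) 0, Real.sin (ω * t) + γ (δ * t) 1]

/-- Planar position `(x, y)` of a follower with state `X = (x, v_x, y, v_y)`. -/
def followerPos (X : EuclideanSpace ℝ (Fin 4)) : EuclideanSpace ℝ (Fin 2) :=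
  !₂[X 0, X 2]

/-- The vector field of a damped follower with state `X = (x, v_x, y, v_y)` that is repelled by a
leader at position `p`. It is meaningful only when the follower is not at `p`. -/
def followerField (A k α : ℝ) (p : EuclideanSpace ℝ (Fin 2)) (X : EuclideanSpace ℝ (Fin 4)) :
    EuclideanSpace ℝ (Fin 4) :=
  !₂[X 1,
    A * (X 0 - p 0) / ((X 0 - p 0) ^ 2 + (X 2 - p 1) ^ 2) ^ α - k * X 1,
    X 3,
    A * (X 2 - p 1) / ((X 0 - p 0) ^ 2 + (X 2 - p 1) ^ 2) ^ α - k * X 3]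

/-- `X` solves, on the time interval `[0, T]`, the initial value problem of the follower driven by
the leader moving along `leaderPos ω δ γ`, with `X 0 = X₀`. The vector field is singular where
follower and leader collide, so a solution has to avoid collisions. -/
structure IsFollowerSolution (A k α ω δ : ℝ) (γ : ℝ → EuclideanSpace ℝ (Fin 2))
    (X₀ : EuclideanSpace ℝ (Fin 4)) (T : ℝ) (X : ℝ → EuclideanSpace ℝ (Fin 4)) : Prop where
  init : X 0 = X₀
  no_collision : ∀ t ∈ Icc 0 T, followerPos (X t) ≠ leaderPos ω δ γ t
  hasDeriv : ∀ t ∈ Icc 0 T,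
    HasDerivWithinAt X (followerField A k α (leaderPos ω δ γ t) (X t)) (Icc 0 T) t

/-- `γ` is a `C¹` target trajectory on `[0, 1]` that starts at the origin and whose speed is
bounded by `M`. -/
structure IsTargetTrajectory (M : ℝ) (γ : ℝ → EuclideanSpace ℝ (Fin 2)) : Prop where
  contDiffOn : ContDiffOn ℝ 1 γ (Icc 0 1)
  init : γ 0 = 0
  speed_le : ∀ s ∈ Icc (0 : ℝ) 1, ‖derivWithin γ (Icc 0 1) s‖ ≤ M

/-- The initial value problem of the follower has exactly one solution on `[0, 1 / δ]`, and along
it the distance of the follower from `γ (δ t)` is smaller than `ρ` throughout `[0, 1 / δ]`. -/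
def TracksWithin (A k α ω δ : ℝ) (γ : ℝ → EuclideanSpace ℝ (Fin 2))
    (X₀ : EuclideanSpace ℝ (Fin 4)) (ρ : ℝ) : Prop :=
  ∃ X : ℝ → EuclideanSpace ℝ (Fin 4),
    IsFollowerSolution A k α ω δ γ X₀ (1 / δ) X ∧
    (∀ Y, IsFollowerSolution A k α ω δ γ X₀ (1 / δ) Y → EqOn Y X (Icc 0 (1 / δ))) ∧
    ∀ t ∈ Icc 0 (1 / δ), ‖followerPos (X t) - γ (δ * t)‖ < ρ

end

open Set Filter Topology

/-! In coordinates relative to the target, the leader sits at `(c, d)`, the point of the unit circle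
at angle `ω t`. Expanded at the centre, the repulsion is `A (-c + x - 2 α (c x + d y) c)` up to a
quadratic error (`abs_force_sub_linear_le`). Its mean over a turn is `-A (α - 1) x`: since `α > 1`,
the fast repeller acts on average as a spring pulling towards the target. The oscillating remainder
is absorbed into a velocity correction of size `O(1 / ω)`.

In the corrected variables the follower is a damped oscillator perturbed by `O(1 / ω)`, `O(δ M)` and
a quadratic term. A Lyapunov energy strictly decreases on a small level set
(`TrapSizes.energyRate_neg`), so its sublevel set is a trap (`TrapSizes.energy_le`).

Existence up to time `1 / δ` comes from a truncated field, globally Lipschitz and bounded; the trap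
keeps its solution where the truncation is inactive. Uniqueness holds because two solutions stay in
a compact collision-free set. -/

/-! ### Second-order expansion of the force -/

/-- Both sides are Bernoulli's inequality, applied to `(1 + s) ^ α` for the upper bound and to `((1
+ s)⁻¹) ^ α` for the lower one. -/
theorem abs_rpow_neg_one_add_sub_le {α s : ℝ} (hα : 1 ≤ α) (hs : |s| * (2 * α) ≤ 1) :
    |(1 + s) ^ (-α) - (1 - α * s)| ≤ 2 * α ^ 2 * s ^ 2 := by
  have hα0 : 0 < α := by linarith
  have hs' : |α * s| ≤ 1 / 2 := by rw [abs_mul, abs_of_pos hα0]; linarith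
  have hs1 : |s| ≤ 1 / 2 := by nlinarith [abs_nonneg s]
  rw [abs_le] at hs' hs1
  have h1s : 0 < 1 + s := by linarith
  have hpos : 0 < (1 + s) ^ α := Real.rpow_pos_of_pos h1s α
  have hup : (1 + s) ^ (-α) ≤ 1 - α * s + 2 * α ^ 2 * s ^ 2 := by
    have hb := one_add_mul_self_le_rpow_one_add (by linarith : -1 ≤ s) hα
    rw [Real.rpow_neg h1s.le, inv_le_iff_one_le_mul₀ hpos]
    have hq : 0 ≤ 1 - α * s + 2 * α ^ 2 * s ^ 2 := by nlinarith
    calc (1 : ℝ) ≤ (1 - α * s + 2 * α ^ 2 * s ^ 2) * (1 + α * s) := by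
          nlinarith [sq_nonneg (α * s), mul_nonneg (sq_nonneg (α * s))
            (by linarith : (0 : ℝ) ≤ 1 + 2 * (α * s))]
      _ ≤ _ := mul_le_mul_of_nonneg_left hb hq
  have hlo : 1 - α * s ≤ (1 + s) ^ (-α) := by
    have h2 : -1 ≤ (1 + s)⁻¹ - 1 := by
      have := inv_pos.2 h1s
      linarith
    have hb := one_add_mul_self_le_rpow_one_add h2 hα
    rw [add_sub_cancel, Real.inv_rpow h1s.le, ← Real.rpow_neg h1s.le] at hb
    refine le_trans ?_ hb
    have h3 : 1 - s ≤ (1 + s)⁻¹ := by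
      rw [le_inv_comm₀ (by linarith) h1s, inv_eq_one_div, le_div_iff₀ (by linarith)]
      nlinarith [sq_nonneg s]
    nlinarith
  rw [abs_le]
  constructor
  · nlinarith [sq_nonneg (α * s)]
  · linarith

/-- Expansion of one component of the repulsive force around the centre of the unit circle, the
leader being at `(c, d)`. -/
theorem abs_force_sub_linear_le {A α c d x y n : ℝ} (hA : 0 < A) (hα : 1 < α)
    (hcd : c ^ 2 + d ^ 2 = 1) (hn : 0 ≤ n) (hn' : 6 * α * n ≤ 1) (hxy : x ^ 2 + y ^ 2 ≤ n ^ 2) :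
    |A * (x - c) / ((x - c) ^ 2 + (y - d) ^ 2) ^ α
      - A * (-c + x - 2 * α * (c * x + d * y) * c)| ≤ 40 * A * α ^ 2 * n ^ 2 := by
  have hα0 : 0 < α := by linarith
  have hn1 : n ≤ 1 := by nlinarith
  set q := c * x + d * y with hq
  set s := -2 * q + (x ^ 2 + y ^ 2) with hs
  have hc : |c| ≤ 1 := abs_le_of_sq_le_sq (by nlinarith [sq_nonneg d]) zero_le_one
  have hx : |x| ≤ n := abs_le_of_sq_le_sq (by nlinarith [sq_nonneg y]) hn
  have hqn : |q| ≤ n := by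
    refine abs_le_of_sq_le_sq ?_ hn
    have : q ^ 2 + (c * y - d * x) ^ 2 = x ^ 2 + y ^ 2 := by
      linear_combination (x ^ 2 + y ^ 2) * hcd
    nlinarith [sq_nonneg (c * y - d * x)]
  have hsn : |s| ≤ 3 * n := by
    rw [abs_le] at hqn ⊢
    constructor <;> nlinarith [sq_nonneg x, sq_nonneg y]
  have hbase : (x - c) ^ 2 + (y - d) ^ 2 = 1 + s := by rw [hs, hq]; linear_combination hcd
  have hT := abs_rpow_neg_one_add_sub_le hα.le (s := s) (by nlinarith [abs_nonneg s])
  set ρ := (1 + s) ^ (-α) - (1 - α * s) with hρ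
  have h1s : 0 ≤ 1 + s := by rw [← hbase]; positivity
  have hs2 : s ^ 2 ≤ 9 * n ^ 2 := by
    have := sq_le_sq' (abs_le.1 hsn).1 (abs_le.1 hsn).2
    linarith
  have hρ' : |ρ| ≤ 18 * α ^ 2 * n ^ 2 :=
    hT.trans (by nlinarith [mul_le_mul_of_nonneg_left hs2 (sq_nonneg α)])
  rw [hbase, div_eq_mul_inv, ← Real.rpow_neg h1s, show (1 + s) ^ (-α) = ρ + (1 - α * s) by ring]
  -- The three remaining terms contribute `1`, `3` and `36` to the constant `40`.
  have e : A * (x - c) * (ρ + (1 - α * s)) - A * (-c + x - 2 * α * q * c)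
      = A * (α * (x ^ 2 + y ^ 2) * c - α * s * x + (x - c) * ρ) := by rw [hs]; ring
  rw [e, abs_mul, abs_of_pos hA]
  have t1 : |α * (x ^ 2 + y ^ 2) * c| ≤ α ^ 2 * n ^ 2 := by
    rw [abs_mul, abs_mul, abs_of_pos hα0, abs_of_nonneg (by positivity)]
    calc α * (x ^ 2 + y ^ 2) * |c| ≤ α * n ^ 2 * 1 := by gcongr
      _ ≤ _ := by nlinarith [mul_nonneg hα0.le (sq_nonneg n)]
  have t2 : |α * s * x| ≤ 3 * α ^ 2 * n ^ 2 := by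
    rw [abs_mul, abs_mul, abs_of_pos hα0]
    calc α * |s| * |x| ≤ α * (3 * n) * n := by gcongr
      _ ≤ _ := by nlinarith [mul_nonneg hα0.le (sq_nonneg n)]
  have t3 : |(x - c) * ρ| ≤ 2 * (18 * α ^ 2 * n ^ 2) := by
    rw [abs_mul]
    have : |x - c| ≤ 2 := (abs_sub x c).trans (by linarith)
    gcongr
  have := abs_add_le (α * (x ^ 2 + y ^ 2) * c - α * s * x) ((x - c) * ρ)
  have := abs_sub (α * (x ^ 2 + y ^ 2) * c) (α * s * x)
  calc A * _ ≤ A * (40 * α ^ 2 * n ^ 2) := by gcongr; linarith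
    _ = _ := by ring

/-! ### Energy of the damped oscillator -/

/-- The Lyapunov function of the damped oscillator `ẍ = -a x - k ẋ`. -/
noncomputable def oscEnergy (a k x w : ℝ) : ℝ := a * x ^ 2 + w ^ 2 / 2 + (w + k * x) ^ 2 / 2

/-- The rate of change of `oscEnergy a k x w` along a motion with velocity `(x', w')`. -/
noncomputable def oscEnergyRate (a k x w x' w' : ℝ) : ℝ :=
  2 * a * x * x' + w * w' + (w + k * x) * (w' + k * x')

theorem HasDerivWithinAt.oscEnergy {x w : ℝ → ℝ} {x' w' t : ℝ} {s : Set ℝ} (a k : ℝ)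
    (hx : HasDerivWithinAt x x' s t) (hw : HasDerivWithinAt w w' s t) :
    HasDerivWithinAt (fun t ↦ oscEnergy a k (x t) (w t)) (oscEnergyRate a k (x t) (w t) x' w')
      s t := by
  have := (((hx.pow 2).const_mul a).add ((hw.pow 2).div_const 2)).add
    (((hw.add (hx.const_mul k)).pow 2).div_const 2)
  refine (this.congr_deriv ?_).congr_of_eventuallyEq ?_ ?_
  · simp only [oscEnergyRate]; simp; ring
  · exact Eventually.of_forall fun t ↦ by simp [_root_.oscEnergy]
  · simp [_root_.oscEnergy]

theorem oscEnergy_ge (a k x w : ℝ) : a * x ^ 2 + w ^ 2 / 2 ≤ oscEnergy a k x w := by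
  unfold oscEnergy; nlinarith [sq_nonneg (w + k * x)]

theorem oscEnergy_le (a k x w : ℝ) :
    oscEnergy a k x w ≤ (a + k ^ 2) * x ^ 2 + 3 / 2 * w ^ 2 := by
  unfold oscEnergy; nlinarith [sq_nonneg (w - k * x)]

/-- For the exact oscillator the cross terms in `x * w` cancel and the dissipation `k (w ^ 2 + a x ^
2)` controls both variables, thanks to the square of `w + k x` in the energy. -/
theorem oscEnergyRate_le {a k x w x' w' n G : ℝ} (ha : 0 < a) (hk : 0 < k)
    (hx : |x| ≤ n) (hw : |w| ≤ n) (h1 : |x' - w| ≤ G) (h2 : |w' - (-a * x - k * w)| ≤ G) :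
    oscEnergyRate a k x w x' w' ≤
      -k * (w ^ 2 + a * x ^ 2) + (2 * a + 2 * k + k ^ 2 + 2) * n * G := by
  have hn : 0 ≤ n := (abs_nonneg _).trans hx
  set g := x' - w with hg
  set h := w' - (-a * x - k * w) with hh
  have e : oscEnergyRate a k x w x' w' =
      -k * (w ^ 2 + a * x ^ 2) + ((2 * a + k ^ 2) * (x * g) + k * (w * g) + 2 * (w * h)
        + k * (x * h)) := by
    rw [hg, hh, oscEnergyRate]; ring
  have hm : ∀ {p q : ℝ}, |p| ≤ n → |q| ≤ G → p * q ≤ n * G := fun {p q} hp hq ↦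
    (le_abs_self _).trans (by rw [abs_mul]; exact mul_le_mul hp hq (abs_nonneg _) hn)
  have m1 := mul_le_mul_of_nonneg_left (hm hx h1) (by positivity : 0 ≤ 2 * a + k ^ 2)
  have m2 := mul_le_mul_of_nonneg_left (hm hw h1) hk.le
  have m3 := hm hw h2
  have m4 := mul_le_mul_of_nonneg_left (hm hx h2) hk.le
  rw [e]; linarith

/-! ### Choice of the trap -/

/-- Sizes for which the energy level `η ^ 2` cannot be crossed: `n` bounds positions and averaged
velocities at that level, and `τ` bounds the perturbations. -/
structure TrapSizes (A k α n η τ : ℝ) : Prop where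
  n_pos : 0 < n
  η_pos : 0 < η
  τ_pos : 0 < τ
  n_le : 6 * α * n ≤ 1
  n_le' : 8 * n ≤ 1
  τ_le : 16 * τ ≤ 1
  η_le : η ^ 2 ≤ A * (α - 1) * n ^ 2
  η_le' : 2 * η ^ 2 ≤ n ^ 2
  start : (2 * (A * (α - 1) + k ^ 2) + 27) * τ ^ 2 ≤ η ^ 2
  decay : 2 * ((2 * (A * (α - 1)) + 2 * k + k ^ 2 + 2) * n *
      ((6 + 2 * k) * τ + 40 * A * α ^ 2 * n ^ 2)) * (3 / 2 * (A * (α - 1)) + k ^ 2 + A * (α - 1))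
      < k * (A * (α - 1)) * η ^ 2

theorem exists_trapSizes {A k α ν : ℝ} (hA : 0 < A) (hk : 0 < k) (hα : 1 < α) (hν : 0 < ν) :
    ∃ n η τ, TrapSizes A k α n η τ ∧ n < ν := by
  have ha : 0 < A * (α - 1) := mul_pos hA (by linarith)
  set a := A * (α - 1) with hadef
  -- `L` is the fixed ratio `n / η`. With `τ = 0` the left side of `decay` is cubic in `η` and the
  -- right side quadratic, so small `η` works; `τ` is chosen afterwards.
  obtain ⟨L, hL0, hL1, hL2⟩ : ∃ L : ℝ, 0 < L ∧ 1 ≤ a * L ^ 2 ∧ 2 ≤ L ^ 2 := by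
    refine ⟨2 + 1 / a, by positivity, ?_, ?_⟩
    · have : a * (2 + 1 / a) ^ 2 = 4 * a + 4 + 1 / a := by field_simp; ring
      have : 0 < 1 / a := by positivity
      linarith
    · have : 0 < 1 / a := by positivity
      nlinarith
  have small : ∀ {f : ℝ → ℝ} {b : ℝ}, Continuous f → f 0 < b → ∀ᶠ x in 𝓝[>] (0 : ℝ), f x < b :=
    fun {f b} hf hb ↦ (hf.tendsto 0).eventually_lt_const hb |>.filter_mono nhdsWithin_le_nhds
  have pos : ∀ᶠ x in 𝓝[>] (0 : ℝ), 0 < x := self_mem_nhdsWithin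
  obtain ⟨η, hη, e1, e2, e3, e4⟩ := (pos.and
    ((small (f := fun η ↦ 6 * α * (L * η)) (b := 1) (by fun_prop) (by simp)).and
    ((small (f := fun η ↦ 8 * (L * η)) (b := 1) (by fun_prop) (by simp)).and
    ((small (f := fun η ↦ L * η) (b := ν) (by fun_prop) (by simpa)).and
    (small (f := fun η ↦ 2 * ((2 * a + 2 * k + k ^ 2 + 2) * L * (40 * A * α ^ 2 * L ^ 2 * η)) *
      (3 / 2 * a + k ^ 2 + a)) (b := k * a) (by fun_prop) (by simp; positivity)))))).exists
  obtain ⟨τ, hτ, f1, f2, f3⟩ := (pos.and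
    ((small (f := fun τ ↦ 16 * τ) (b := 1) (by fun_prop) (by simp)).and
    ((small (f := fun τ ↦ (2 * (a + k ^ 2) + 27) * τ ^ 2) (b := η ^ 2) (by fun_prop)
      (by simp; positivity)).and
    (small (f := fun τ ↦ 2 * ((2 * a + 2 * k + k ^ 2 + 2) * (L * η) *
      ((6 + 2 * k) * τ + 40 * A * α ^ 2 * (L * η) ^ 2)) * (3 / 2 * a + k ^ 2 + a))
      (b := k * a * η ^ 2) (by fun_prop) (by nlinarith [sq_pos_of_pos hη]))))).exists
  exact ⟨L * η, η, τ, ⟨by positivity, hη, hτ, e1.le, e2.le, f1.le, by nlinarith [sq_nonneg η],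
    by nlinarith [sq_nonneg η], f2.le, f3⟩, e3⟩

/-! ### Averaging by a velocity correction -/

/-- First component of the velocity, corrected by the fast oscillation it undergoes. -/
noncomputable def avgVelX (A α ω t x y u : ℝ) : ℝ :=
  u + A / ω * (Real.sin (ω * t) + α / 2 * (Real.sin (2 * (ω * t)) * x - Real.cos (2 * (ω * t)) * y))

/-- Second component of the velocity, corrected by the fast oscillation it undergoes. -/
noncomputable def avgVelY (A α ω t x y v : ℝ) : ℝ :=
  v - A / ω * (Real.cos (ω * t) + α / 2 * (Real.cos (2 * (ω * t)) * x + Real.sin (2 * (ω * t)) * y))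

section

variable {A α ω t x' y' u' v' : ℝ} {x y u v : ℝ → ℝ} {s : Set ℝ}

/-- The correction is minus the time antiderivative of the oscillating linearised force with
positions frozen. Its explicit time derivative cancels that force; moving positions leave only a `1
/ ω` term. -/
theorem HasDerivWithinAt.avgVelX (hω : ω ≠ 0) (hx : HasDerivWithinAt x x' s t)
    (hy : HasDerivWithinAt y y' s t) (hu : HasDerivWithinAt u u' s t) :
    HasDerivWithinAt (fun t ↦ avgVelX A α ω t (x t) (y t) (u t))
      (u' + A * Real.cos (ω * t) + A * α * (Real.cos (2 * (ω * t)) * x t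
        + Real.sin (2 * (ω * t)) * y t)
        + A / ω * (α / 2) * (Real.sin (2 * (ω * t)) * x' - Real.cos (2 * (ω * t)) * y')) s t := by
  have h1 : HasDerivWithinAt (fun t ↦ ω * t) ω s t := by
    simpa using (hasDerivWithinAt_id t s).const_mul ω
  have h2 := h1.const_mul 2
  have := hu.add ((h1.sin.add (((h2.sin.mul hx).sub (h2.cos.mul hy)).const_mul (α / 2))).const_mul
    (A / ω))
  refine this.congr_deriv ?_
  field_simp
  ring

theorem HasDerivWithinAt.avgVelY (hω : ω ≠ 0) (hx : HasDerivWithinAt x x' s t)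
    (hy : HasDerivWithinAt y y' s t) (hv : HasDerivWithinAt v v' s t) :
    HasDerivWithinAt (fun t ↦ avgVelY A α ω t (x t) (y t) (v t))
      (v' + A * Real.sin (ω * t) + A * α * (Real.sin (2 * (ω * t)) * x t
        - Real.cos (2 * (ω * t)) * y t)
        - A / ω * (α / 2) * (Real.cos (2 * (ω * t)) * x' + Real.sin (2 * (ω * t)) * y')) s t := by
  have h1 : HasDerivWithinAt (fun t ↦ ω * t) ω s t := by
    simpa using (hasDerivWithinAt_id t s).const_mul ω
  have h2 := h1.const_mul 2
  have := hv.sub ((h1.cos.add (((h2.cos.mul hx).add (h2.sin.mul hy)).const_mul (α / 2))).const_mul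
    (A / ω))
  refine this.congr_deriv ?_
  field_simp
  ring

end

theorem abs_mul_add_mul_le {p q x y n m : ℝ} (hp : |p| ≤ 1) (hq : |q| ≤ 1) (hx : |x| ≤ n)
    (hy : |y| ≤ m) : |p * x + q * y| ≤ n + m := by
  refine (abs_add_le _ _).trans ?_
  rw [abs_mul, abs_mul]
  nlinarith [abs_nonneg p, abs_nonneg q, abs_nonneg x, abs_nonneg y]

theorem abs_mul_sub_mul_le {p q x y n m : ℝ} (hp : |p| ≤ 1) (hq : |q| ≤ 1) (hx : |x| ≤ n)
    (hy : |y| ≤ m) : |p * x - q * y| ≤ n + m := by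
  simpa [sub_eq_add_neg] using abs_mul_add_mul_le hp (by rwa [abs_neg] : |-q| ≤ 1) hx hy

theorem abs_avgVelX_sub_le {A α ω τ n : ℝ} (t x y u : ℝ) (hA : 0 < A) (hα : 1 < α) (hω : 0 < ω)
    (hτ : A * α / ω ≤ τ) (hx : |x| ≤ n) (hy : |y| ≤ n) (hn : n ≤ 1) :
    |avgVelX A α ω t x y u - u| ≤ 2 * τ := by
  have h := abs_mul_sub_mul_le (Real.abs_sin_le_one (2 * (ω * t))) (Real.abs_cos_le_one (2 * (ω * t))) hx hy
  have h0 := Real.abs_sin_le_one (ω * t)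
  rw [avgVelX, add_sub_cancel_left, abs_mul, abs_of_pos (div_pos hA hω)]
  have h2 : |Real.sin (ω * t) + α / 2 * (Real.sin (2 * (ω * t)) * x
      - Real.cos (2 * (ω * t)) * y)| ≤ 2 * α := by
    refine (abs_add_le _ _).trans ?_
    rw [abs_mul, abs_of_pos (by linarith : 0 < α / 2)]
    nlinarith
  calc _ ≤ A / ω * (2 * α) := by gcongr
    _ = 2 * (A * α / ω) := by ring
    _ ≤ _ := by linarith

theorem abs_avgVelY_sub_le {A α ω τ n : ℝ} (t x y v : ℝ) (hA : 0 < A) (hα : 1 < α) (hω : 0 < ω)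
    (hτ : A * α / ω ≤ τ) (hx : |x| ≤ n) (hy : |y| ≤ n) (hn : n ≤ 1) :
    |avgVelY A α ω t x y v - v| ≤ 2 * τ := by
  have h := abs_mul_add_mul_le (Real.abs_cos_le_one (2 * (ω * t))) (Real.abs_sin_le_one (2 * (ω * t))) hx hy
  have h0 := Real.abs_cos_le_one (ω * t)
  rw [avgVelY, sub_sub_cancel_left, abs_neg, abs_mul, abs_of_pos (div_pos hA hω)]
  have h2 : |Real.cos (ω * t) + α / 2 * (Real.cos (2 * (ω * t)) * x
      + Real.sin (2 * (ω * t)) * y)| ≤ 2 * α := by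
    refine (abs_add_le _ _).trans ?_
    rw [abs_mul, abs_of_pos (by linarith : 0 < α / 2)]
    nlinarith
  calc _ ≤ A / ω * (2 * α) := by gcongr
    _ = 2 * (A * α / ω) := by ring
    _ ≤ _ := by linarith

/-! ### The energy level as a barrier -/

/-- The energy of the follower relative to the target, in averaged velocities. -/
noncomputable def followerEnergy (A k α ω t x u y v : ℝ) : ℝ :=
  oscEnergy (A * (α - 1)) k x (avgVelX A α ω t x y u) +
    oscEnergy (A * (α - 1)) k y (avgVelY A α ω t x y v)

namespace TrapSizes

variable {A k α n η τ ω : ℝ}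

theorem bounds_of_energy_le (h : TrapSizes A k α n η τ) (hA : 0 < A) (hα : 1 < α) (hω : 0 < ω)
    (hτ : A * α / ω ≤ τ) {t x u y v : ℝ} (hV : followerEnergy A k α ω t x u y v ≤ η ^ 2) :
    x ^ 2 + y ^ 2 ≤ n ^ 2 ∧ |x| ≤ n ∧ |y| ≤ n ∧ |avgVelX A α ω t x y u| ≤ n ∧
      |avgVelY A α ω t x y v| ≤ n ∧ |u| ≤ 1 / 4 ∧ |v| ≤ 1 / 4 := by
  have ha : 0 < A * (α - 1) := mul_pos hA (by linarith)
  have hn := h.n_pos.le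
  have hn1 := h.n_le'
  have ht1 := h.τ_le
  rw [followerEnergy] at hV
  set p := avgVelX A α ω t x y u with hp
  set q := avgVelY A α ω t x y v with hq
  have e1 := oscEnergy_ge (A * (α - 1)) k x p
  have e2 := oscEnergy_ge (A * (α - 1)) k y q
  have e3 := h.η_le
  have e4 := h.η_le'
  have x2 := mul_nonneg ha.le (sq_nonneg x)
  have y2 := mul_nonneg ha.le (sq_nonneg y)
  have hxy : x ^ 2 + y ^ 2 ≤ n ^ 2 := by
    refine le_of_mul_le_mul_left ?_ ha
    nlinarith [sq_nonneg p, sq_nonneg q]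
  have hx : |x| ≤ n := abs_le_of_sq_le_sq (by nlinarith [sq_nonneg y]) hn
  have hy : |y| ≤ n := abs_le_of_sq_le_sq (by nlinarith [sq_nonneg x]) hn
  have hpn : |p| ≤ n := abs_le_of_sq_le_sq (by nlinarith [sq_nonneg q]) hn
  have hqn : |q| ≤ n := abs_le_of_sq_le_sq (by nlinarith [sq_nonneg p]) hn
  have b1 := abs_avgVelX_sub_le t x y u hA hα hω hτ hx hy (by linarith)
  have b2 := abs_avgVelY_sub_le t x y v hA hα hω hτ hx hy (by linarith)
  rw [← hp] at b1
  rw [← hq] at b2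
  refine ⟨hxy, hx, hy, hpn, hqn, ?_, ?_⟩
  -- `n + 2 * τ ≤ 1 / 8 + 1 / 8`, which is the truncation threshold of `clampState`.
  · rw [abs_le] at *; constructor <;> linarith
  · rw [abs_le] at *; constructor <;> linarith

theorem energy_start_le (h : TrapSizes A k α n η τ) (hA : 0 < A) (hα : 1 < α) (hω : 0 < ω)
    (hτ : A * α / ω ≤ τ) {t x u y v : ℝ} (hx : |x| ≤ τ) (hu : |u| ≤ τ) (hy : |y| ≤ τ)
    (hv : |v| ≤ τ) : followerEnergy A k α ω t x u y v ≤ η ^ 2 := by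
  have ha : 0 < A * (α - 1) := mul_pos hA (by linarith)
  have ht1 := h.τ_le
  have hs := h.start
  have b1 := abs_avgVelX_sub_le t x y u hA hα hω hτ hx hy (by linarith)
  have b2 := abs_avgVelY_sub_le t x y v hA hα hω hτ hx hy (by linarith)
  rw [followerEnergy]
  set p := avgVelX A α ω t x y u with hp
  set q := avgVelY A α ω t x y v with hq
  have e1 := oscEnergy_le (A * (α - 1)) k x p
  have e2 := oscEnergy_le (A * (α - 1)) k y q
  have hp3 : |p| ≤ 3 * τ := by rw [abs_le] at *; constructor <;> linarith
  have hq3 : |q| ≤ 3 * τ := by rw [abs_le] at *; constructor <;> linarith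
  have c1 := sq_le_sq' (abs_le.1 hp3).1 (abs_le.1 hp3).2
  have c2 := sq_le_sq' (abs_le.1 hq3).1 (abs_le.1 hq3).2
  have c3 := sq_le_sq' (abs_le.1 hx).1 (abs_le.1 hx).2
  have c4 := sq_le_sq' (abs_le.1 hy).1 (abs_le.1 hy).2
  have hK : 0 ≤ A * (α - 1) + k ^ 2 := by positivity
  nlinarith [mul_le_mul_of_nonneg_left c3 hK, mul_le_mul_of_nonneg_left c4 hK]

/-- On the level set the dissipation is at least of order `η ^ 2`, while the perturbations
contribute at most order `n * G`; `decay` makes the former win. -/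
theorem energyRate_neg (h : TrapSizes A k α n η τ) (hA : 0 < A) (hk : 0 < k) (hα : 1 < α)
    (hω : 0 < ω) (hτ : A * α / ω ≤ τ) {t x u y v x' u' y' v' : ℝ}
    (hV : followerEnergy A k α ω t x u y v = η ^ 2)
    (hx' : |x' - u| ≤ τ) (hy' : |y' - v| ≤ τ)
    (hu' : u' = A * (x - Real.cos (ω * t)) /
      ((x - Real.cos (ω * t)) ^ 2 + (y - Real.sin (ω * t)) ^ 2) ^ α - k * u)
    (hv' : v' = A * (y - Real.sin (ω * t)) /
      ((x - Real.cos (ω * t)) ^ 2 + (y - Real.sin (ω * t)) ^ 2) ^ α - k * v) :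
    oscEnergyRate (A * (α - 1)) k x (avgVelX A α ω t x y u) x'
      (u' + A * Real.cos (ω * t) + A * α * (Real.cos (2 * (ω * t)) * x
        + Real.sin (2 * (ω * t)) * y)
        + A / ω * (α / 2) * (Real.sin (2 * (ω * t)) * x' - Real.cos (2 * (ω * t)) * y')) +
    oscEnergyRate (A * (α - 1)) k y (avgVelY A α ω t x y v) y'
      (v' + A * Real.sin (ω * t) + A * α * (Real.sin (2 * (ω * t)) * x
        - Real.cos (2 * (ω * t)) * y)
        - A / ω * (α / 2) * (Real.cos (2 * (ω * t)) * x' + Real.sin (2 * (ω * t)) * y')) < 0 := by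
  have ha : 0 < A * (α - 1) := mul_pos hA (by linarith)
  obtain ⟨hxy, hx, hy, hp, hq, hu, hv⟩ := h.bounds_of_energy_le hA hα hω hτ hV.le
  have hn := h.n_pos.le
  have hn1 := h.n_le'
  have ht0 := h.τ_pos
  have ht1 := h.τ_le
  have hdec := h.decay
  have b1 := abs_avgVelX_sub_le t x y u hA hα hω hτ hx hy (by linarith)
  have b2 := abs_avgVelY_sub_le t x y v hA hα hω hτ hx hy (by linarith)
  rw [followerEnergy] at hV
  set p := avgVelX A α ω t x y u
  set q := avgVelY A α ω t x y v
  set c := Real.cos (ω * t)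
  set d := Real.sin (ω * t)
  have hcd : c ^ 2 + d ^ 2 = 1 := Real.cos_sq_add_sin_sq _
  have f1 := abs_force_sub_linear_le hA hα hcd hn h.n_le hxy
  -- The second component follows by exchanging the two coordinates.
  have f2 := abs_force_sub_linear_le (c := d) (d := c) (x := y) (y := x) hA hα (by linarith) hn
    h.n_le (by linarith)
  rw [add_comm ((y - d) ^ 2)] at f2
  have hx1 : |x'| ≤ 1 := by rw [abs_le] at *; constructor <;> linarith
  have hy1 : |y'| ≤ 1 := by rw [abs_le] at *; constructor <;> linarith
  have r1 := abs_mul_sub_mul_le (Real.abs_sin_le_one (2 * (ω * t)))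
    (Real.abs_cos_le_one (2 * (ω * t))) hx1 hy1
  have r2 := abs_mul_add_mul_le (Real.abs_cos_le_one (2 * (ω * t)))
    (Real.abs_sin_le_one (2 * (ω * t))) hx1 hy1
  -- The double-angle formulas split the quadratic coefficients `c ^ 2`, `d ^ 2`, `c * d` into their
  -- means and the oscillation removed by the correction.
  have hC : Real.cos (2 * (ω * t)) = 2 * c ^ 2 - 1 := Real.cos_two_mul _
  have hC' : Real.cos (2 * (ω * t)) = 1 - 2 * d ^ 2 := by rw [hC]; linarith
  have hS : Real.sin (2 * (ω * t)) = 2 * d * c := Real.sin_two_mul _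
  set C := Real.cos (2 * (ω * t))
  set S := Real.sin (2 * (ω * t))
  set ρ₁ := A * (x - c) / ((x - c) ^ 2 + (y - d) ^ 2) ^ α
    - A * (-c + x - 2 * α * (c * x + d * y) * c) with hρ₁
  set ρ₂ := A * (y - d) / ((x - c) ^ 2 + (y - d) ^ 2) ^ α
    - A * (-d + y - 2 * α * (d * y + c * x) * d) with hρ₂
  have hb : A / ω * (α / 2) * 2 ≤ τ := by
    rw [show A / ω * (α / 2) * 2 = A * α / ω by ring]; exact hτ
  have hb0 : 0 ≤ A / ω * (α / 2) := by
    have := div_pos hA hω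
    have : 0 < α / 2 := by linarith
    positivity
  have r1' : |A / ω * (α / 2) * (S * x' - C * y')| ≤ τ := by
    rw [abs_mul, abs_of_nonneg hb0]
    exact (mul_le_mul_of_nonneg_left r1 hb0).trans (by linarith)
  have r2' : |A / ω * (α / 2) * (C * x' + S * y')| ≤ τ := by
    rw [abs_mul, abs_of_nonneg hb0]
    exact (mul_le_mul_of_nonneg_left r2 hb0).trans (by linarith)
  set z₁ := A / ω * (α / 2) * (S * x' - C * y')
  set z₂ := A / ω * (α / 2) * (C * x' + S * y')
  have k1 : |k * (p - u)| ≤ k * (2 * τ) := by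
    rw [abs_mul, abs_of_pos hk]; exact mul_le_mul_of_nonneg_left b1 hk.le
  have k2 : |k * (q - v)| ≤ k * (2 * τ) := by
    rw [abs_mul, abs_of_pos hk]; exact mul_le_mul_of_nonneg_left b2 hk.le
  set G := (6 + 2 * k) * τ + 40 * A * α ^ 2 * n ^ 2 with hG
  have hq0 : 0 ≤ 40 * A * α ^ 2 * n ^ 2 := by positivity
  have hkt := mul_pos hk ht0
  have g1 : |x' - p| ≤ G := by rw [abs_le] at *; constructor <;> linarith
  have g2 : |y' - q| ≤ G := by rw [abs_le] at *; constructor <;> linarith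
  have e1 : u' + A * c + A * α * (C * x + S * y) + z₁ - (-(A * (α - 1)) * x - k * p)
      = ρ₁ + k * (p - u) + z₁ := by
    rw [hρ₁, hu', hC, hS]; ring
  have e2 : v' + A * d + A * α * (S * x - C * y) - z₂ - (-(A * (α - 1)) * y - k * q)
      = ρ₂ + k * (q - v) - z₂ := by
    rw [hρ₂, hv', hC', hS]; ring
  have g3 : |u' + A * c + A * α * (C * x + S * y) + z₁ - (-(A * (α - 1)) * x - k * p)| ≤ G := by
    rw [e1]; rw [abs_le] at *; constructor <;> linarith
  have g4 : |v' + A * d + A * α * (S * x - C * y) - z₂ - (-(A * (α - 1)) * y - k * q)| ≤ G := by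
    rw [e2]; rw [abs_le] at *; constructor <;> linarith
  have l1 := oscEnergyRate_le ha hk hx hp g1 g3
  have l2 := oscEnergyRate_le ha hk hy hq g2 g4
  have m1 := oscEnergy_le (A * (α - 1)) k x p
  have m2 := oscEnergy_le (A * (α - 1)) k y q
  refine (add_le_add l1 l2).trans_lt ?_
  set a := A * (α - 1)
  set E := (p ^ 2 + q ^ 2) + a * (x ^ 2 + y ^ 2) with hE
  set D := 3 / 2 * a + k ^ 2 + a with hD
  have hD0 : 0 < D := by positivity
  -- `D` is chosen so that `D * E` dominates `a` times the upper bound `oscEnergy_le` of the energy,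
  -- whose value here is `η ^ 2`.
  have hED : a * η ^ 2 ≤ D * E := by
    have : a * η ^ 2 ≤ a * ((a + k ^ 2) * (x ^ 2 + y ^ 2) + 3 / 2 * (p ^ 2 + q ^ 2)) :=
      mul_le_mul_of_nonneg_left (by linarith) ha.le
    have p1 : 0 ≤ a * a * (x ^ 2 + y ^ 2) := by positivity
    have p2 : 0 ≤ (k ^ 2 + a) * (p ^ 2 + q ^ 2) := by positivity
    rw [hD, hE]
    linarith
  have hfin : 2 * ((2 * a + 2 * k + k ^ 2 + 2) * n * G) < k * E := by
    refine lt_of_mul_lt_mul_right (a := D) ?_ hD0.le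
    have := mul_le_mul_of_nonneg_left hED hk.le
    linarith
  linarith

end TrapSizes

/-! ### Regularity of the field in relative states -/

/-- The state of a follower that rests at the position `p`. -/
noncomputable def restState (p : EuclideanSpace ℝ (Fin 2)) : EuclideanSpace ℝ (Fin 4) :=
  !₂[p 0, 0, p 1, 0]

/-- Translation invariance: only positions are shifted, velocities stay absolute. It reduces all
regularity questions to one autonomous field, singular at the origin of the plane. -/
theorem followerField_eq_sub_restState (A k α : ℝ) (p : EuclideanSpace ℝ (Fin 2))
    (X : EuclideanSpace ℝ (Fin 4)) :
    followerField A k α p X = followerField A k α 0 (X - restState p) := by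
  ext i
  fin_cases i <;> simp [followerField, restState]

theorem continuous_restState : Continuous restState := by
  unfold restState
  fun_prop

theorem contDiffAt_followerField (A k α : ℝ) {Z : EuclideanSpace ℝ (Fin 4)}
    (hZ : Z 0 ^ 2 + Z 2 ^ 2 ≠ 0) : ContDiffAt ℝ 1 (followerField A k α 0) Z := by
  have hc (i : Fin 4) : ContDiffAt ℝ 1 (fun Z : EuclideanSpace ℝ (Fin 4) ↦ Z i) Z :=
    contDiffAt_euclidean.1 contDiffAt_id i
  have hpow : ContDiffAt ℝ 1 (fun Z : EuclideanSpace ℝ (Fin 4) ↦ (Z 0 ^ 2 + Z 2 ^ 2) ^ α) Z :=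
    (((hc 0).pow 2).add ((hc 2).pow 2)).rpow_const_of_ne hZ
  have hne : (Z 0 ^ 2 + Z 2 ^ 2) ^ α ≠ 0 :=
    (Real.rpow_pos_of_pos (lt_of_le_of_ne (by positivity) hZ.symm) α).ne'
  rw [contDiffAt_euclidean]
  intro i
  fin_cases i
  · simpa [followerField] using hc 1
  · simpa [followerField] using ((contDiffAt_const.mul (hc 0)).div hpow hne).sub
      (contDiffAt_const.mul (hc 1))
  · simpa [followerField] using hc 3
  · simpa [followerField] using ((contDiffAt_const.mul (hc 2)).div hpow hne).sub
      (contDiffAt_const.mul (hc 3))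

theorem exists_lipschitzOnWith_followerField (A k α : ℝ) {K : Set (EuclideanSpace ℝ (Fin 4))}
    (hK : IsCompact K) (h : ∀ Z ∈ K, Z 0 ^ 2 + Z 2 ^ 2 ≠ 0) :
    ∃ C, LipschitzOnWith C (followerField A k α 0) K := by
  refine LocallyLipschitzOn.exists_lipschitzOnWith_of_compact hK fun Z hZ ↦ ?_
  obtain ⟨C, t, ht, hC⟩ := (contDiffAt_followerField A k α (h Z hZ)).exists_lipschitzOnWith
  exact ⟨C, t, mem_nhdsWithin_of_mem_nhds ht, hC⟩

theorem exists_forall_hasDerivWithinAt_of_bounded_of_lipschitz {E : Type*} [NormedAddCommGroup E]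
    [NormedSpace ℝ E] [CompleteSpace E] {f : ℝ → E → E} {T : ℝ} (hT : 0 ≤ T) {K L : NNReal}
    (hlip : ∀ t ∈ Icc 0 T, LipschitzWith K (f t)) (hcont : ∀ x, ContinuousOn (f · x) (Icc 0 T))
    (hL : ∀ t ∈ Icc 0 T, ∀ x, ‖f t x‖ ≤ L) (x₀ : E) :
    ∃ X : ℝ → E, X 0 = x₀ ∧ ∀ t ∈ Icc 0 T, HasDerivWithinAt X (f t (X t)) (Icc 0 T) t := by
  -- At speed at most `L`, a ball of radius `L * T` cannot be left within time `T`, so one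
  -- application covers the whole interval.
  have h : IsPicardLindelof f (⟨0, left_mem_Icc.2 hT⟩ : Icc 0 T) x₀ (L * T.toNNReal) 0 L K :=
    { lipschitzOnWith := fun t ht ↦ (hlip t ht).lipschitzOnWith
      continuousOn := fun x _ ↦ hcont x
      norm_le := fun t ht x _ ↦ hL t ht x
      mul_max_le := by simp [hT] }
  exact h.exists_eq_forall_mem_Icc_hasDerivWithinAt₀

/-! ### Truncation and global existence -/

/-- Truncation of every coordinate to `[-1/4, 1/4]`. -/
noncomputable def clampState (Y : EuclideanSpace ℝ (Fin 4)) : EuclideanSpace ℝ (Fin 4) :=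
  WithLp.toLp 2 fun i ↦ max (-(1 / 4)) (min (1 / 4) (Y i))

theorem lipschitzWith_clampState : LipschitzWith 1 clampState := by
  refine LipschitzWith.of_dist_le_mul fun Y Z ↦ ?_
  rw [NNReal.coe_one, one_mul, EuclideanSpace.dist_eq, EuclideanSpace.dist_eq]
  refine Real.sqrt_le_sqrt (Finset.sum_le_sum fun i _ ↦ ?_)
  refine pow_le_pow_left₀ dist_nonneg ?_ 2
  rw [Real.dist_eq, Real.dist_eq]
  refine (abs_max_sub_max_le_max _ _ _ _).trans (max_le (by simp) ?_)
  exact (abs_min_sub_min_le_max _ _ _ _).trans (max_le (by simp) le_rfl)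

theorem abs_clampState_le (Y : EuclideanSpace ℝ (Fin 4)) (i : Fin 4) :
    |clampState Y i| ≤ 1 / 4 := by
  rw [abs_le]
  exact ⟨le_max_left _ _, max_le (by norm_num) (min_le_left _ _)⟩

theorem clampState_eq_self {Y : EuclideanSpace ℝ (Fin 4)} (h : ∀ i, |Y i| ≤ 1 / 4) :
    clampState Y = Y := by
  ext i
  have := abs_le.1 (h i)
  change max (-(1 / 4)) (min (1 / 4) (Y i)) = Y i
  rw [min_eq_right this.2, max_eq_right this.1]

theorem leaderPos_eq (ω δ : ℝ) (γ : ℝ → EuclideanSpace ℝ (Fin 2)) (t : ℝ) :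
    leaderPos ω δ γ t = !₂[Real.cos (ω * t), Real.sin (ω * t)] + γ (δ * t) := by
  ext i
  fin_cases i <;> simp [leaderPos]

theorem restState_add (p q : EuclideanSpace ℝ (Fin 2)) :
    restState (p + q) = restState p + restState q := by
  ext i
  fin_cases i <;> simp [restState]

theorem followerPos_ne_iff {X : EuclideanSpace ℝ (Fin 4)} {p : EuclideanSpace ℝ (Fin 2)} :
    followerPos X ≠ p ↔ (X - restState p) 0 ^ 2 + (X - restState p) 2 ^ 2 ≠ 0 := by
  rw [not_iff_not]
  constructor
  · rintro rfl
    simp [restState, followerPos]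
  · intro h
    have h0 : X 0 - p 0 = 0 := by
      simp [restState] at h
      nlinarith [sq_nonneg (X 0 - p 0), sq_nonneg (X 2 - p 1)]
    have h1 : X 2 - p 1 = 0 := by
      simp [restState] at h
      nlinarith [sq_nonneg (X 0 - p 0), sq_nonneg (X 2 - p 1)]
    ext i
    fin_cases i
    · simpa [followerPos] using sub_eq_zero.1 h0
    · simpa [followerPos] using sub_eq_zero.1 h1

theorem quarter_le_sq_add_sq {c d x y : ℝ} (hcd : c ^ 2 + d ^ 2 = 1) (hx : |x| ≤ 1 / 4)
    (hy : |y| ≤ 1 / 4) : 1 / 4 ≤ (x - c) ^ 2 + (y - d) ^ 2 := by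
  rw [abs_le] at hx hy
  nlinarith [sq_nonneg (c - 2 * x), sq_nonneg (d - 2 * y)]

/-- Relative states that are bounded and stay away from a collision. -/
def annulusStates : Set (EuclideanSpace ℝ (Fin 4)) :=
  Metric.closedBall 0 4 ∩ {Z | 1 / 4 ≤ Z 0 ^ 2 + Z 2 ^ 2}

theorem isCompact_annulusStates : IsCompact annulusStates :=
  (isCompact_closedBall _ _).inter_right (isClosed_le (by fun_prop) (by fun_prop))

theorem clampState_sub_mem_annulusStates (Y : EuclideanSpace ℝ (Fin 4)) (θ : ℝ) :
    clampState Y - restState !₂[Real.cos θ, Real.sin θ] ∈ annulusStates := by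
  have h := abs_clampState_le Y
  constructor
  · have hc := Real.abs_cos_le_one θ
    have hs := Real.abs_sin_le_one θ
    rw [mem_closedBall_zero_iff, EuclideanSpace.norm_eq]
    refine Real.sqrt_le_iff.2 ⟨by norm_num, ?_⟩
    have key : ∀ i, ‖(clampState Y - restState !₂[Real.cos θ, Real.sin θ]) i‖ ^ 2 ≤ 4 := by
      intro i
      have hi := h i
      rw [abs_le] at hi hc hs
      rw [Real.norm_eq_abs, sq_abs]
      fin_cases i <;> simp [restState] at hi ⊢ <;> nlinarith
    calc _ ≤ ∑ i : Fin 4, (4 : ℝ) := Finset.sum_le_sum fun i _ ↦ key i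
      _ = _ := by norm_num
  · simpa [restState] using quarter_le_sq_add_sq (Real.cos_sq_add_sin_sq θ) (h 0) (h 2)

/-- The field of the follower, frozen at truncated states relative to the target `g`. -/
noncomputable def truncatedField (A k α θ : ℝ) (g : EuclideanSpace ℝ (Fin 2))
    (X : EuclideanSpace ℝ (Fin 4)) : EuclideanSpace ℝ (Fin 4) :=
  followerField A k α 0
    (clampState (X - restState g) - restState !₂[Real.cos θ, Real.sin θ])

/-- Truncated states relative to the leader always lie in the compact set `annulusStates`, where the
field is Lipschitz and bounded. -/
theorem exists_truncated_solution (A k α ω : ℝ) {T : ℝ} (hT : 0 ≤ T)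
    {Γ : ℝ → EuclideanSpace ℝ (Fin 2)} (hΓ : ContinuousOn Γ (Icc 0 T))
    (X₀ : EuclideanSpace ℝ (Fin 4)) :
    ∃ X : ℝ → EuclideanSpace ℝ (Fin 4), X 0 = X₀ ∧ ∀ t ∈ Icc 0 T,
      HasDerivWithinAt X (truncatedField A k α (ω * t) (Γ t) (X t)) (Icc 0 T) t := by
  obtain ⟨C, hC⟩ := exists_lipschitzOnWith_followerField A k α isCompact_annulusStates
    fun Z hZ ↦ (lt_of_lt_of_le (by norm_num) hZ.2).ne'
  obtain ⟨B, hB⟩ := isCompact_annulusStates.exists_bound_of_continuousOn hC.continuousOn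
  have hcirc : Continuous fun t ↦ restState !₂[Real.cos (ω * t), Real.sin (ω * t)] :=
    continuous_restState.comp (by fun_prop)
  refine exists_forall_hasDerivWithinAt_of_bounded_of_lipschitz hT (K := C) (L := B.toNNReal)
    (f := fun t X ↦ truncatedField A k α (ω * t) (Γ t) X) (fun t _ ↦ ?_) (fun X ↦ ?_)
    (fun t _ X ↦ ?_) X₀
  · refine LipschitzWith.of_dist_le_mul fun X Y ↦ ?_
    refine (hC.dist_le_mul _ (clampState_sub_mem_annulusStates _ _) _
      (clampState_sub_mem_annulusStates _ _)).trans ?_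
    gcongr
    rw [dist_sub_right]
    simpa using lipschitzWith_clampState.dist_le_mul (X - restState (Γ t)) (Y - restState (Γ t))
  · refine hC.continuousOn.comp ?_ fun t _ ↦ clampState_sub_mem_annulusStates _ _
    exact (lipschitzWith_clampState.continuous.comp_continuousOn
      (continuousOn_const.sub (continuous_restState.comp_continuousOn hΓ))).sub hcirc.continuousOn
  · exact (hB _ (clampState_sub_mem_annulusStates _ _)).trans (Real.le_coe_toNNReal B)

theorem truncatedField_eq {A k α ω δ t : ℝ} {γ : ℝ → EuclideanSpace ℝ (Fin 2)}
    {X : EuclideanSpace ℝ (Fin 4)} (h : ∀ i, |(X - restState (γ (δ * t))) i| ≤ 1 / 4) :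
    truncatedField A k α (ω * t) (γ (δ * t)) X =
      followerField A k α (leaderPos ω δ γ t) X := by
  rw [truncatedField, clampState_eq_self h, followerField_eq_sub_restState _ _ _ _ X,
    leaderPos_eq, restState_add]
  congr 1
  abel

/-! ### Uniqueness -/

theorem IsFollowerSolution.eqOn {A k α ω δ T : ℝ} {γ : ℝ → EuclideanSpace ℝ (Fin 2)}
    {X₀ : EuclideanSpace ℝ (Fin 4)} {X Y : ℝ → EuclideanSpace ℝ (Fin 4)}
    (hγ : ContinuousOn (fun t ↦ γ (δ * t)) (Icc 0 T))
    (hX : IsFollowerSolution A k α ω δ γ X₀ T X) (hY : IsFollowerSolution A k α ω δ γ X₀ T Y) :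
    EqOn Y X (Icc 0 T) := by
  have hp : ContinuousOn (fun t ↦ restState (leaderPos ω δ γ t)) (Icc 0 T) := by
    refine continuous_restState.comp_continuousOn ?_
    rw [funext (leaderPos_eq ω δ γ)]
    exact ContinuousOn.add (Continuous.continuousOn (by fun_prop)) hγ
  have cont : ∀ {Z}, IsFollowerSolution A k α ω δ γ X₀ T Z → ContinuousOn Z (Icc 0 T) :=
    fun h t ht ↦ (h.hasDeriv t ht).continuousWithinAt
  have right : ∀ {Z}, IsFollowerSolution A k α ω δ γ X₀ T Z → ∀ t ∈ Ico 0 T,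
      HasDerivWithinAt Z (followerField A k α (leaderPos ω δ γ t) (Z t)) (Ici t) t :=
    fun h t ht ↦ (h.hasDeriv t (Ico_subset_Icc_self ht)).mono_of_mem_nhdsWithin
      (Icc_mem_nhdsGE_of_mem ht)
  -- The union of both relative orbits is compact and avoids the singularity, so the field is
  -- Lipschitz on it; no convexity is needed for Grönwall.
  set K := (fun t ↦ X t - restState (leaderPos ω δ γ t)) '' Icc 0 T ∪
    (fun t ↦ Y t - restState (leaderPos ω δ γ t)) '' Icc 0 T with hKdef
  have hK : IsCompact K := (isCompact_Icc.image_of_continuousOn ((cont hX).sub hp)).union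
    (isCompact_Icc.image_of_continuousOn ((cont hY).sub hp))
  obtain ⟨C, hC⟩ := exists_lipschitzOnWith_followerField A k α hK (by
    rintro _ (⟨t, ht, rfl⟩ | ⟨t, ht, rfl⟩)
    · exact followerPos_ne_iff.1 (hX.no_collision t ht)
    · exact followerPos_ne_iff.1 (hY.no_collision t ht))
  refine ODE_solution_unique_of_mem_Icc_right (K := C)
    (v := fun t ↦ followerField A k α (leaderPos ω δ γ t))
    (s := fun t ↦ {Z | Z - restState (leaderPos ω δ γ t) ∈ K})
    (fun t _ ↦ ?_) (cont hY) (right hY) ?_ (cont hX) (right hX) ?_ (hY.init.trans hX.init.symm)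
  · refine LipschitzOnWith.of_dist_le_mul fun Z hZ W hW ↦ ?_
    rw [followerField_eq_sub_restState, followerField_eq_sub_restState _ _ _ _ W]
    simpa only [dist_sub_right] using hC.dist_le_mul _ hZ _ hW
  · exact fun t ht ↦ Or.inr ⟨t, Ico_subset_Icc_self ht, rfl⟩
  · exact fun t ht ↦ Or.inl ⟨t, Ico_subset_Icc_self ht, rfl⟩

/-! ### Trapping and tracking -/

theorem HasDerivWithinAt.euclideanSpace_apply {ι : Type*} [Fintype ι] {f : ℝ → EuclideanSpace ℝ ι}
    {f' : EuclideanSpace ℝ ι} {s : Set ℝ} {t : ℝ} (h : HasDerivWithinAt f f' s t) (i : ι) :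
    HasDerivWithinAt (fun t ↦ f t i) (f' i) s t :=
  (EuclideanSpace.proj (𝕜 := ℝ) i).hasFDerivAt.comp_hasDerivWithinAt t h

/-- A barrier argument for the truncated equation. The sign of the derivative matters only where the
energy equals `η ^ 2`, and there the truncation is inactive, so the estimate for the true field
applies. -/
theorem TrapSizes.energy_le {A k α n η τ ω δ T : ℝ} (h : TrapSizes A k α n η τ) (hA : 0 < A)
    (hk : 0 < k) (hα : 1 < α) (hω : 0 < ω) (hτ : A * α / ω ≤ τ)
    {X : ℝ → EuclideanSpace ℝ (Fin 4)} {γ Γ' : ℝ → EuclideanSpace ℝ (Fin 2)}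
    (hγ0 : γ 0 = 0) (hX0 : ‖X 0‖ ≤ τ)
    (hγ : ∀ t ∈ Icc 0 T, HasDerivWithinAt (fun t ↦ γ (δ * t)) (Γ' t) (Icc 0 T) t)
    (hΓ' : ∀ t ∈ Icc 0 T, ‖Γ' t‖ ≤ τ)
    (hX : ∀ t ∈ Icc 0 T,
      HasDerivWithinAt X (truncatedField A k α (ω * t) (γ (δ * t)) (X t)) (Icc 0 T) t) :
    ∀ t ∈ Icc 0 T, followerEnergy A k α ω t (X t 0 - γ (δ * t) 0) (X t 1)
      (X t 2 - γ (δ * t) 1) (X t 3) ≤ η ^ 2 := by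
  set V : ℝ → ℝ := fun t ↦ followerEnergy A k α ω t (X t 0 - γ (δ * t) 0) (X t 1)
      (X t 2 - γ (δ * t) 1) (X t 3) with hVdef
  have hV : ∀ t ∈ Icc 0 T, ∃ V', HasDerivWithinAt V V' (Icc 0 T) t ∧ (V t = η ^ 2 → V' < 0) := by
    intro t ht
    have hx := ((hX t ht).euclideanSpace_apply 0).sub ((hγ t ht).euclideanSpace_apply 0)
    have hu := (hX t ht).euclideanSpace_apply 1
    have hy := ((hX t ht).euclideanSpace_apply 2).sub ((hγ t ht).euclideanSpace_apply 1)
    have hv := (hX t ht).euclideanSpace_apply 3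
    have d1 := hx.oscEnergy (A * (α - 1)) k
      (HasDerivWithinAt.avgVelX (A := A) (α := α) hω.ne' hx hy hu)
    have d2 := hy.oscEnergy (A * (α - 1)) k
      (HasDerivWithinAt.avgVelY (A := A) (α := α) hω.ne' hx hy hv)
    refine ⟨_, d1.add d2, fun hVt ↦ ?_⟩
    obtain ⟨-, bx, by', -, -, bu, bv⟩ := h.bounds_of_energy_le hA hα hω hτ hVt.le
    have hn := h.n_le'
    rw [truncatedField_eq (by
      intro i
      fin_cases i
      · simpa [restState] using bx.trans (by linarith)
      · simpa [restState] using bu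
      · simpa [restState] using by'.trans (by linarith)
      · simpa [restState] using bv)]
    have bΓ (i : Fin 2) : |Γ' t i| ≤ τ := (PiLp.norm_apply_le (Γ' t) i).trans (hΓ' t ht)
    refine h.energyRate_neg hA hk hα hω hτ hVt ?_ ?_ ?_ ?_
    · simpa [followerField] using bΓ 0
    · simpa [followerField] using bΓ 1
    · simp [followerField, leaderPos, sub_sub, add_comm]
    · simp [followerField, leaderPos, sub_sub, add_comm]
  choose! V' hV' hneg using hV
  refine image_le_of_deriv_right_lt_deriv_boundary' (f' := V') (B := fun _ ↦ η ^ 2)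
    (B' := fun _ ↦ 0) (fun t ht ↦ (hV' t ht).continuousWithinAt) (fun t ht ↦ ?_) ?_
    continuousOn_const (fun t _ ↦ hasDerivWithinAt_const _ _ _)
    (fun t ht ↦ hneg t (Ico_subset_Icc_self ht))
  · exact (hV' t (Ico_subset_Icc_self ht)).mono_of_mem_nhdsWithin (Icc_mem_nhdsGE_of_mem ht)
  · have b (i : Fin 4) : |X 0 i| ≤ τ := (PiLp.norm_apply_le (X 0) i).trans hX0
    exact h.energy_start_le hA hα hω hτ (by simpa [hγ0] using b 0) (b 1)
      (by simpa [hγ0] using b 2) (b 3)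

theorem IsTargetTrajectory.hasDerivWithinAt {M δ : ℝ} {γ : ℝ → EuclideanSpace ℝ (Fin 2)}
    (h : IsTargetTrajectory M γ) (hδ : 0 < δ) {t : ℝ} (ht : t ∈ Icc 0 (1 / δ)) :
    HasDerivWithinAt (fun t ↦ γ (δ * t)) (δ • derivWithin γ (Icc 0 1) (δ * t))
      (Icc 0 (1 / δ)) t ∧ ‖δ • derivWithin γ (Icc 0 1) (δ * t)‖ ≤ δ * M := by
  have hmaps : MapsTo (fun t ↦ δ * t) (Icc 0 (1 / δ)) (Icc 0 1) := fun s hs ↦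
    ⟨mul_nonneg hδ.le hs.1, by have := (le_div_iff₀ hδ).1 hs.2; linarith⟩
  constructor
  · have h1 : HasDerivWithinAt (fun t ↦ δ * t) δ (Icc 0 (1 / δ)) t := by
      simpa using (hasDerivWithinAt_id t (Icc 0 (1 / δ))).const_mul δ
    exact ((h.contDiffOn.differentiableOn one_ne_zero _ (hmaps ht)).hasDerivWithinAt).scomp t h1
      hmaps
  · rw [norm_smul, Real.norm_of_nonneg hδ.le]
    exact mul_le_mul_of_nonneg_left (h.speed_le _ (hmaps ht)) hδ.le

/-- The energy bound keeps every relative coordinate within `1 / 4`, so the truncated solution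
solves the original problem and stays away from the leader. -/
theorem TrapSizes.tracksWithin {A k α n η τ ω δ M ν : ℝ} (h : TrapSizes A k α n η τ) (hA : 0 < A)
    (hk : 0 < k) (hα : 1 < α) (hω : 0 < ω) (hτ : A * α / ω ≤ τ) (hδ : 0 < δ) (hδM : δ * M ≤ τ)
    (hν : n < ν) {γ : ℝ → EuclideanSpace ℝ (Fin 2)} (hγ : IsTargetTrajectory M γ)
    {X₀ : EuclideanSpace ℝ (Fin 4)} (hX₀ : ‖X₀‖ ≤ τ) : TracksWithin A k α ω δ γ X₀ ν := by
  have hcont : ContinuousOn (fun t ↦ γ (δ * t)) (Icc 0 (1 / δ)) :=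
    fun t ht ↦ (hγ.hasDerivWithinAt hδ ht).1.continuousWithinAt
  obtain ⟨X, hX0, hX⟩ := exists_truncated_solution A k α ω (one_div_pos.2 hδ).le hcont X₀
  have henergy := h.energy_le hA hk hα hω hτ hγ.init (hX0 ▸ hX₀)
    (fun t ht ↦ (hγ.hasDerivWithinAt hδ ht).1)
    (fun t ht ↦ (hγ.hasDerivWithinAt hδ ht).2.trans hδM) hX
  have hn := h.n_le'
  have hcoord : ∀ t ∈ Icc 0 (1 / δ), ∀ i, |(X t - restState (γ (δ * t))) i| ≤ 1 / 4 := by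
    intro t ht i
    obtain ⟨-, bx, by', -, -, bu, bv⟩ := h.bounds_of_energy_le hA hα hω hτ (henergy t ht)
    fin_cases i
    · simpa [restState] using bx.trans (by linarith)
    · simpa [restState] using bu
    · simpa [restState] using by'.trans (by linarith)
    · simpa [restState] using bv
  have hsol : IsFollowerSolution A k α ω δ γ X₀ (1 / δ) X := by
    refine ⟨hX0, fun t ht ↦ followerPos_ne_iff.2 ?_, fun t ht ↦ ?_⟩
    · have := (clampState_sub_mem_annulusStates (X t - restState (γ (δ * t))) (ω * t)).2
      rw [clampState_eq_self (hcoord t ht)] at this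
      rw [leaderPos_eq, restState_add, add_comm (restState _), ← sub_sub]
      exact (lt_of_lt_of_le (by norm_num : (0 : ℝ) < 1 / 4) this).ne'
    · rw [← truncatedField_eq (hcoord t ht)]
      exact hX t ht
  refine ⟨X, hsol, fun Y hY ↦ hsol.eqOn hcont hY, fun t ht ↦ lt_of_le_of_lt ?_ hν⟩
  obtain ⟨hxy, -⟩ := h.bounds_of_energy_le hA hα hω hτ (henergy t ht)
  rw [EuclideanSpace.norm_eq]
  exact Real.sqrt_le_iff.2 ⟨h.n_pos.le, by simpa [followerPos, Fin.sum_univ_two] using hxy⟩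

/-- The size `τ` is fixed before `M` appears; it serves as the initial radius and bounds both `A * α
/ ω` and `δ * M`. Both claims are instances of this statement. -/
theorem exists_tracksWithin {A k α ν : ℝ} (hA : 0 < A) (hk : 0 < k) (hα : 1 < α) (hν : 0 < ν) :
    ∃ r > (0 : ℝ), ∃ ω₀ > (0 : ℝ), ∀ M > (0 : ℝ), ∃ δ₀ > (0 : ℝ),
      ∀ γ : ℝ → EuclideanSpace ℝ (Fin 2), IsTargetTrajectory M γ →
      ∀ ω > ω₀, ∀ δ ∈ Ioo 0 δ₀, ∀ X₀ : EuclideanSpace ℝ (Fin 4), ‖X₀‖ ≤ r →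
        TracksWithin A k α ω δ γ X₀ ν := by
  obtain ⟨n, η, τ, h, hnν⟩ := exists_trapSizes hA hk hα hν
  have hτ := h.τ_pos
  have hα0 : 0 < α := by linarith
  have hω₀ : 0 < A * α / τ := by positivity
  refine ⟨τ, hτ, A * α / τ, hω₀, fun M hM ↦ ⟨τ / M, by positivity, ?_⟩⟩
  intro γ hγ ω hω δ hδ X₀ hX₀
  have hω0 : 0 < ω := hω₀.trans hω
  refine h.tracksWithin hA hk hα hω0 ?_ hδ.1 ((lt_div_iff₀ hM).1 hδ.2).le hnν hγ hX₀
  rw [div_le_iff₀ hω0]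
  have := (div_lt_iff₀ hτ).1 hω
  linarith

theorem mainTheorem2 (A k α : ℝ) (hA : 0 < A) (hk : 0 < k) (hα : 1 < α) :
    (∃ r₁ > (0 : ℝ), ∃ ω₁ > (0 : ℝ), ∀ M > (0 : ℝ), ∃ δ₁ > (0 : ℝ),
      ∀ γ : ℝ → EuclideanSpace ℝ (Fin 2), IsTargetTrajectory M γ →
      ∀ ω > ω₁, ∀ δ ∈ Ioo 0 δ₁, ∀ X₀ : EuclideanSpace ℝ (Fin 4), ‖X₀‖ ≤ r₁ →
        TracksWithin A k α ω δ γ X₀ 1) ∧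
    (∀ ν > (0 : ℝ), ∃ ω₂ > (0 : ℝ), ∀ M > (0 : ℝ), ∃ δ₂ > (0 : ℝ),
      ∀ γ : ℝ → EuclideanSpace ℝ (Fin 2), IsTargetTrajectory M γ →
      ∀ ω > ω₂, ∀ δ ∈ Ioo 0 δ₂, TracksWithin A k α ω δ γ 0 ν) := by
  refine ⟨exists_tracksWithin hA hk hα one_pos, fun ν hν ↦ ?_⟩
  obtain ⟨r, hr, ω₀, hω₀, h⟩ := exists_tracksWithin hA hk hα hν
  refine ⟨ω₀, hω₀, fun M hM ↦ ?_⟩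
  obtain ⟨δ₀, hδ₀, h⟩ := h M hM
  exact ⟨δ₀, hδ₀, fun γ hγ ω hω δ hδ ↦ h γ hγ ω hω δ hδ 0 (by simpa using hr.le)⟩
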